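/- All digraphs are finite; loops and multiple edges are allowed. Let $G$ be a strongly connected digraph with vertex set $V$ and let $s\in V$ (the sink). Write $\deg^+_G(v)$ for the number of edges with source $v$. An $s$-configuration is a vector $c\in\mathbb{N}_0^{V\setminus\{s\}}$; it is stable if $c(v)<\deg^+_G(v)$ for all $v\ne s$. A vertex $v\neq s$ with $c(v)\ge\deg^+_G(v)$ may legally fire: it loses $\deg^+_G(v)$ chips and one chip is sent along each edge leaving $v$, chips sent to $s$ being removed. Write $c^\circ$ for the unique stable $s$-configuration reached from $c$ by legal firings. A configuration $c$ is $s$-recurrent if for every $s$-configuration $c_1$ there is an $s$-configuration $c_2$ with $(c_1+c_2)^\circ=c$. Let $u_s\in\mathbb{N}_0^{V\setminus\{s\}}$ be the vector whose entry at $v$ is the number of edges from $s$ to $v$. On the set of $s$-recurrent configurations, let $c\sim d$ mean that $d=(c+k\,u_s)^\circ$ for some $k\in\mathbb{N}_0$; this is an equivalence relation. The Biggs–Merino polynomial of $G$ with sink $s$ is $$\mathcal{B}(G,s;y)=\sum_{[c]} y^{\mathrm{dlvl}([c])},\qquad \mathrm{dlvl}([c])=\max_{c'\in[c]}\Bigl(\deg^+_G(s)+\sum_{v\neq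 s}c'(v)\Bigr),$$ where the sum is over the equivalence classes of $s$-recurrent configurations. **Lemma 5.1.** (i) Let $G$ be a strongly connected digraph with vertex set $V$, let $s\in V$, let $d\ge 1$ be an integer, and let $G^d$ be the digraph obtained from $G$ by replacing every edge with $d$ copies of it. Then $$\mathcal{B}(G^d,s;y)=\mathcal{B}(G,s;y^d)\cdot\left(\frac{1-y^d}{1-y}\right)^{|V|-1}.$$ (ii) As a consequence, let $n,a,b$ be positive integers, let $d=\gcd(a,b)$, and let $G(n;a,b)$ be the digraph with vertices $v_1,\dots,v_n$ and with $a$ edges from $v_i$ to $v_{i+1}$ and $b$ edges from $v_{i+1}$ to $v_i$ for each $1\le i\le n-1$. Then for every vertex $s$ of $G(n;a,b)$, $$\mathcal{B}(G(n;a,b),s;y)=y^{(n-1)(a+b-d)}\left(\frac{1-y^d}{1-y}\right)^{n-1}.$$ -/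

import Mathlib

/-- A directed graph with vertex set `V` and edge set `E`, loops and multiple edges allowed:
each edge `e` goes from its source `src e` to its target `tgt e`. -/
structure MultiDigraph (V E : Type*) where
  src : E → V
  tgt : E → V

namespace MultiDigraph

/-- There is a directed path (possibly of length zero) between any two vertices. -/
def StronglyConnected {V E : Type*} (G : MultiDigraph V E) : Prop :=
  ∀ v w : V, Relation.ReflTransGen (fun x y => ∃ e, G.src e = x ∧ G.tgt e = y) v w

/-- The digraph `G^d`: the same vertices, and `d` copies of every edge of `G`. -/
def replicate {V E : Type*} (G : MultiDigraph V E) (d : ℕ) : MultiDigraph V (E × Fin d) where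
  src e := G.src e.1
  tgt e := G.tgt e.1

/-- The digraph `G(n; a, b)` on the vertices `v₁, …, vₙ` (numbered `0, …, n - 1` here): for each
pair of consecutive vertices, `a` edges from the first to the second and `b` edges back. -/
def biPath (n a b : ℕ) : MultiDigraph (Fin n) (Fin (n - 1) × (Fin a ⊕ Fin b)) where
  src e := match e.2 with
    | Sum.inl _ => ⟨e.1.val, by have := e.1.isLt; omega⟩
    | Sum.inr _ => ⟨e.1.val + 1, by have := e.1.isLt; omega⟩
  tgt e := match e.2 with
    | Sum.inl _ => ⟨e.1.val + 1, by have := e.1.isLt; omega⟩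
    | Sum.inr _ => ⟨e.1.val, by have := e.1.isLt; omega⟩

/-- The number of edges from `v` to `w`. -/
def mult {V E : Type*} [DecidableEq V] [Fintype E] (G : MultiDigraph V E) (v w : V) : ℕ :=
  (Finset.univ.filter fun e => G.src e = v ∧ G.tgt e = w).card

/-- The outdegree of `v` (loops at `v` are counted). -/
def outdeg {V E : Type*} [DecidableEq V] [Fintype E] (G : MultiDigraph V E) (v : V) : ℕ :=
  (Finset.univ.filter fun e => G.src e = v).card

/-- An `s`-configuration: a number of chips at each vertex other than the sink `s`. -/
abbrev SConfig {V : Type*} (s : V) : Type _ := {v : V // v ≠ s} → ℕ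

/-- `d` arises from `c` by one legal `s`-firing move: a vertex `v ≠ s` with at least
`outdeg v` chips loses `outdeg v` chips, and one chip is sent along each edge leaving `v`;
chips sent to `s` disappear. -/
def SFires {V E : Type*} [DecidableEq V] [Fintype E] (G : MultiDigraph V E) (s : V)
    (c d : SConfig s) : Prop :=
  ∃ v : {v : V // v ≠ s}, G.outdeg v ≤ c v ∧
    ∀ w, d w + (if w = v then G.outdeg v else 0) = c w + G.mult v w

/-- `d` is accessible from `c` by a finite sequence of legal `s`-firing moves. -/
def SAccessible {V E : Type*} [DecidableEq V] [Fintype E] (G : MultiDigraph V E) (s : V) :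
    SConfig s → SConfig s → Prop :=
  Relation.ReflTransGen (G.SFires s)

def SStable {V E : Type*} [DecidableEq V] [Fintype E] (G : MultiDigraph V E) (s : V)
    (c : SConfig s) : Prop :=
  ∀ v, c v < G.outdeg v

/-- `c° = d`: the `s`-configuration `c` stabilizes to `d`. -/
def Stabilizes {V E : Type*} [DecidableEq V] [Fintype E] (G : MultiDigraph V E) (s : V)
    (c d : SConfig s) : Prop :=
  G.SAccessible s c d ∧ G.SStable s d

/-- `c` is `s`-recurrent: for every `c₁` there is `c₂` with `(c₁ + c₂)° = c`. -/
def SRecurrent {V E : Type*} [DecidableEq V] [Fintype E] (G : MultiDigraph V E) (s : V)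
    (c : SConfig s) : Prop :=
  ∀ c₁ : SConfig s, ∃ c₂ : SConfig s, G.Stabilizes s (c₁ + c₂) c

/-- The set `Rec(G, s)` of `s`-recurrent configurations. -/
def SRec {V E : Type*} [DecidableEq V] [Fintype E] (G : MultiDigraph V E) (s : V) : Type _ :=
  {c : SConfig s // G.SRecurrent s c}

/-- The `s`-configuration `u_s`, whose value at `v` is the number of edges from `s` to `v`. -/
def sinkVector {V E : Type*} [DecidableEq V] [Fintype E] (G : MultiDigraph V E) (s : V) :
    SConfig s :=
  fun v => G.mult s v

/-- `c ~ d` iff `d = (c + k u_s)°` for some natural number `k`. -/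
def SEquiv {V E : Type*} [DecidableEq V] [Fintype E] (G : MultiDigraph V E) (s : V)
    (c d : G.SRec s) : Prop :=
  ∃ k : ℕ, G.Stabilizes s (c.1 + k • G.sinkVector s) d.1

/-- The set of equivalence classes of `s`-recurrent configurations. (On a strongly connected
digraph `SEquiv` is an equivalence relation, so the equivalence relation it generates, which
`Quot` divides out, is `SEquiv` itself.) -/
def SRecClass {V E : Type*} [DecidableEq V] [Fintype E] (G : MultiDigraph V E) (s : V) :
    Type _ :=
  Quot (G.SEquiv s)

instance finite_sRec {V E : Type*} [Fintype V] [DecidableEq V] [Fintype E]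
    (G : MultiDigraph V E) (s : V) : Finite (G.SRec s) := by
  have hf : (Set.univ.pi fun v : {v : V // v ≠ s} => Set.Iio (G.outdeg v)).Finite :=
    Set.Finite.pi fun v => Set.finite_Iio _
  refine (hf.subset ?_).to_subtype
  intro c hc v _
  obtain ⟨c₂, h⟩ := hc 0
  exact h.2 v

instance finite_sRecClass {V E : Type*} [Fintype V] [DecidableEq V] [Fintype E]
    (G : MultiDigraph V E) (s : V) : Finite (G.SRecClass s) :=
  inferInstanceAs (Finite (Quot (G.SEquiv s)))

noncomputable instance fintypeSRecClass {V E : Type*} [Fintype V] [DecidableEq V] [Fintype E]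
    (G : MultiDigraph V E) (s : V) : Fintype (G.SRecClass s) :=
  Fintype.ofFinite _

/-- The d-level of an `s`-configuration: the outdegree of the sink plus the number of chips. -/
def dlvl {V E : Type*} [Fintype V] [DecidableEq V] [Fintype E] (G : MultiDigraph V E) (s : V)
    (c : SConfig s) : ℕ :=
  G.outdeg s + ∑ v, c v

/-- The d-level of a class: the maximum of the d-levels of its members (the maximum exists, see
`isGreatest_classDlvl`). -/
noncomputable def classDlvl {V E : Type*} [Fintype V] [DecidableEq V] [Fintype E]
    (G : MultiDigraph V E) (s : V) (q : G.SRecClass s) : ℕ :=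
  sSup {m | ∃ c : G.SRec s, Quot.mk _ c = q ∧ G.dlvl s c.1 = m}

theorem isGreatest_classDlvl {V E : Type*} [Fintype V] [DecidableEq V] [Fintype E]
    (G : MultiDigraph V E) (s : V) (q : G.SRecClass s) :
    IsGreatest {m | ∃ c : G.SRec s, Quot.mk _ c = q ∧ G.dlvl s c.1 = m} (G.classDlvl s q) := by
  have hfin : {m | ∃ c : G.SRec s, Quot.mk _ c = q ∧ G.dlvl s c.1 = m}.Finite := by
    refine (Set.finite_range fun c : G.SRec s => G.dlvl s c.1).subset ?_
    rintro m ⟨c, _, rfl⟩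
    exact ⟨c, rfl⟩
  obtain ⟨c, hc⟩ := Quot.exists_rep q
  exact ⟨Nat.sSup_mem ⟨_, c, hc, rfl⟩ hfin.bddAbove, fun m hm => le_csSup hfin.bddAbove hm⟩

/-- The Biggs–Merino polynomial `B(G, s; y)`. -/
noncomputable def biggsMerino {V E : Type*} [Fintype V] [DecidableEq V] [Fintype E]
    (G : MultiDigraph V E) (s : V) : Polynomial ℤ :=
  ∑ q : G.SRecClass s, Polynomial.X ^ G.classDlvl s q

end MultiDigraph

/-!
Firing in a digraph depends only on the edge multiplicities and the outdegrees. If both are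
multiplied by `d`, then a firing moves chips in multiples of `d`: writing a configuration as
`d c + r` with remainders `r v < d`, the vector `r` never changes and the quotient `c` evolves as
in the original digraph. Hence stabilization, recurrence and the relation `SEquiv` are those of
the quotients together with equality of the remainders (`IsScaling.classEquiv`), and the d-level
of a class is `d` times the old one plus `∑ r` (`IsScaling.classDlvl_classEquiv_symm`). Summing
over `r` gives one factor `1 + y + ⋯ + y ^ (d - 1)` for each vertex other than the sink.

For the path with `a` edges forward and `b` edges backward, dividing by `gcd a b` reduces the claim
to coprime `a` and `b`, where the polynomial is a monomial because there is a single class. This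
rests on three facts.

* Every configuration stabilizes, since a strictly superharmonic potential decreases with each
  firing (`exists_stabilizes`, `exists_stabilizes_biPath`).
* By confluence of legal firing, each coset of the lattice of firing vectors contains at most one
  recurrent configuration (`SRecurrent.eq_of_chips_sub_mem`). So the classes are at most as many
  as the cosets of the lattice spanned by the firing vectors and the sink vector.
* For coprime `a` and `b` that lattice is everything (`firingLattice_biPath_sup_eq_top`): the
  differences `f i` of consecutive coordinate vectors satisfy `a f (i + 1) ≡ b f i`, and they
  vanish at both ends.

The single class contains the configuration with `outdeg v - 1` chips at each `v`, which dominates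
every stable configuration and so has the largest d-level, the number of edges minus the number
of vertices other than the sink (`biggsMerino_eq_X_pow`).
-/

namespace MultiDigraph

/-! ### Configurations as integer vectors -/

/-- A configuration as an integer vector. -/
def chips {V : Type*} {s : V} (c : SConfig s) : {v : V // v ≠ s} → ℤ := fun v => c v

@[simp]
theorem chips_apply {V : Type*} {s : V} (c : SConfig s) (v : {v : V // v ≠ s}) : chips c v = c v :=
  rfl

theorem chips_add {V : Type*} {s : V} (c d : SConfig s) : chips (c + d) = chips c + chips d := by
  ext v
  simp

section Confluence

variable {V E : Type*} [DecidableEq V] [Fintype E] {G : MultiDigraph V E} {s : V}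

/-! ### Confluence of legal firing -/

theorem SFires.add_right {c d : SConfig s} (h : G.SFires s c d) (x : SConfig s) :
    G.SFires s (c + x) (d + x) := by
  obtain ⟨v, hv, hw⟩ := h
  refine ⟨v, hv.trans (Nat.le_add_right _ _), fun w => ?_⟩
  have := hw w
  simp only [Pi.add_apply]
  omega

theorem SAccessible.add_right {c d : SConfig s} (h : G.SAccessible s c d) (x : SConfig s) :
    G.SAccessible s (c + x) (d + x) :=
  Relation.ReflTransGen.lift (p := G.SFires s) (· + x) (fun _ _ h => SFires.add_right h x) _ _ h

/-- Two different vertices can fire in either order with the same result. -/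
theorem SFires.diamond {c d e : SConfig s} (hd : G.SFires s c d) (he : G.SFires s c e) :
    ∃ f, Relation.ReflGen (G.SFires s) d f ∧ Relation.ReflTransGen (G.SFires s) e f := by
  obtain ⟨v, hv, hd⟩ := hd
  obtain ⟨w, hw, he⟩ := he
  by_cases hvw : v = w
  · subst hvw
    refine ⟨d, .refl, ?_⟩
    have : e = d := by
      funext u
      have h1 := hd u
      have h2 := he u
      omega
    rw [this]
  · refine ⟨fun u => d u + G.mult w u - (if u = w then G.outdeg w else 0),
      .single ⟨w, ?_, fun u => ?_⟩, .single ⟨v, ?_, fun u => ?_⟩⟩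
    · have := hd w
      rw [if_neg (Ne.symm hvw)] at this
      omega
    · have h1 := hd u
      have h2 := he u
      by_cases huw : u = w
      · subst huw
        rw [if_neg (Ne.symm hvw)] at h1
        simp only [if_true]
        omega
      · simp [huw]
    · have := he v
      rw [if_neg hvw] at this
      omega
    · have h1 := hd u
      have h2 := he u
      by_cases huw : u = w
      · subst huw
        rw [if_neg (Ne.symm hvw)] at h1 ⊢
        simp only [if_true] at h2 ⊢
        omega
      · simp only [if_neg huw] at h2 ⊢
        omega

/-- Two configurations are joinable if some configuration is accessible from both. By
confluence this is the equivalence relation generated by legal firing. -/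
def SJoinable (G : MultiDigraph V E) (s : V) : SConfig s → SConfig s → Prop :=
  Relation.Join (G.SAccessible s)

theorem sJoinable_equivalence : Equivalence (G.SJoinable s) :=
  Relation.equivalence_join_reflTransGen fun _ _ _ => SFires.diamond

theorem SAccessible.sJoinable {c d : SConfig s} (h : G.SAccessible s c d) :
    G.SJoinable s c d :=
  ⟨d, h, .refl⟩

theorem SStable.eq_of_sAccessible {c d : SConfig s} (hc : G.SStable s c)
    (h : G.SAccessible s c d) : d = c := by
  induction h using Relation.ReflTransGen.head_induction_on with
  | refl => rfl
  | head h _ _ =>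
    obtain ⟨v, hv, _⟩ := h
    exact absurd (hc v) (not_lt.2 hv)

theorem SStable.eq_of_sJoinable {c d : SConfig s} (hc : G.SStable s c) (hd : G.SStable s d)
    (h : G.SJoinable s c d) : c = d := by
  obtain ⟨e, h1, h2⟩ := h
  rw [← hc.eq_of_sAccessible h1, ← hd.eq_of_sAccessible h2]

theorem SRecurrent.sStable {c : SConfig s} (hc : G.SRecurrent s c) : G.SStable s c :=
  (hc 0).choose_spec.2

/-- Chips may be added to a recurrent configuration before stabilizing without losing
recurrence. -/
theorem SRecurrent.of_stabilizes_add {c d x : SConfig s} (hc : G.SRecurrent s c)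
    (h : G.Stabilizes s (c + x) d) : G.SRecurrent s d := by
  intro c₁
  obtain ⟨c₂, h₂⟩ := hc c₁
  refine ⟨c₂ + x, ?_, h.2⟩
  rw [← add_assoc]
  exact Relation.ReflTransGen.trans (h₂.1.add_right x) h.1

/-! ### The lattice of firing vectors -/

/-- The net loss of chips when `v` fires: the row of `v` in the reduced Laplacian. -/
def firingVector (G : MultiDigraph V E) (s : V) (v : {v : V // v ≠ s}) :
    {v : V // v ≠ s} → ℤ :=
  fun w => (if w = v then (G.outdeg v : ℤ) else 0) - G.mult v w

/-- The lattice spanned by the rows of the reduced Laplacian. -/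
def firingLattice (G : MultiDigraph V E) (s : V) : AddSubgroup ({v : V // v ≠ s} → ℤ) :=
  AddSubgroup.closure (Set.range (G.firingVector s))

theorem SAccessible.chips_sub_mem {c d : SConfig s} (h : G.SAccessible s c d) :
    chips c - chips d ∈ G.firingLattice s := by
  induction h with
  | refl => simp
  | @tail d e _ h ih =>
    obtain ⟨v, _, hv⟩ := h
    have key : chips d - chips e = G.firingVector s v := by
      ext w
      have h1 : (e w : ℤ) + (if w = v then (G.outdeg v : ℤ) else 0) = d w + G.mult v w := by
        exact_mod_cast hv w
      simp only [Pi.sub_apply, chips_apply, firingVector]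
      omega
    rw [← sub_add_sub_cancel (chips c) (chips d) (chips e), key]
    exact add_mem ih (AddSubgroup.subset_closure ⟨v, rfl⟩)

/-- A lattice vector can be realized by legal firings and their reversals once enough chips
are present everywhere. -/
theorem exists_forall_sJoinable {z : {v : V // v ≠ s} → ℤ} (hz : z ∈ G.firingLattice s) :
    ∃ B : SConfig s, ∀ x y : SConfig s, B ≤ x → chips x - chips y = z →
      G.SJoinable s x y := by
  induction hz using AddSubgroup.closure_induction with
  | mem z hz =>
    obtain ⟨v, rfl⟩ := hz
    refine ⟨fun w => G.outdeg w, fun x y hx h =>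
      SAccessible.sJoinable (.single ⟨v, hx v, fun w => ?_⟩)⟩
    have := congrFun h w
    simp only [Pi.sub_apply, chips_apply, firingVector] at this
    zify
    omega
  | zero =>
    refine ⟨0, fun x y _ h => ?_⟩
    have : x = y := by
      ext v
      have := congrFun h v
      simp only [Pi.sub_apply, chips_apply, Pi.zero_apply] at this
      omega
    exact this ▸ sJoinable_equivalence.refl x
  | add z₁ z₂ _ _ h₁ h₂ =>
    obtain ⟨B₁, h₁⟩ := h₁
    obtain ⟨B₂, h₂⟩ := h₂
    refine ⟨fun v => B₁ v + B₂ v + (z₁ v).natAbs, fun x y hx h => ?_⟩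
    refine sJoinable_equivalence.trans (h₁ x (fun v => (x v - z₁ v).toNat) ?_ ?_) (h₂ _ y ?_ ?_)
    · intro v
      have : B₁ v + B₂ v + (z₁ v).natAbs ≤ x v := hx v
      show B₁ v ≤ x v
      omega
    · ext v
      have : B₁ v + B₂ v + (z₁ v).natAbs ≤ x v := hx v
      simp only [Pi.sub_apply, chips_apply]
      omega
    · intro v
      have : B₁ v + B₂ v + (z₁ v).natAbs ≤ x v := hx v
      show _ ≤ (x v - z₁ v).toNat
      omega
    · ext v
      have : B₁ v + B₂ v + (z₁ v).natAbs ≤ x v := hx v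
      have := congrFun h v
      simp only [Pi.sub_apply, chips_apply, Pi.add_apply] at this ⊢
      omega
  | neg z _ h =>
    obtain ⟨B, hB⟩ := h
    refine ⟨fun v => B v + (z v).natAbs, fun x y hx h =>
      sJoinable_equivalence.symm (hB y x ?_ ?_)⟩
    · intro v
      have : B v + (z v).natAbs ≤ x v := hx v
      have := congrFun h v
      simp only [Pi.sub_apply, chips_apply, Pi.neg_apply] at this
      show B v ≤ y v
      omega
    · rw [← neg_sub, h, neg_neg]

/-- Each coset of the firing lattice contains at most one recurrent configuration. -/
theorem SRecurrent.eq_of_chips_sub_mem (hG : ∀ c, ∃ d, G.Stabilizes s c d) {c d : SConfig s}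
    (hc : G.SRecurrent s c) (hd : G.SRecurrent s d)
    (h : chips c - chips d ∈ G.firingLattice s) : c = d := by
  obtain ⟨B, hB⟩ := exists_forall_sJoinable h
  let D : SConfig s := fun v => B v + G.outdeg v
  obtain ⟨t, ht, hts⟩ := hG D
  -- `x` is a large element of the lattice, and adding it does not change the class of a
  -- recurrent configuration: it acts as a neutral element.
  obtain ⟨x, hx⟩ : ∃ x : SConfig s, t + x = D :=
    ⟨fun v => B v + G.outdeg v - t v, by
      ext v
      have := hts v
      simp only [Pi.add_apply, D]
      omega⟩
  have hBx : B ≤ x := fun v => by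
    have h1 : t v < G.outdeg v := hts v
    have h2 : t v + x v = B v + G.outdeg v := congrFun hx v
    show B v ≤ x v
    omega
  have key : ∀ e, G.SRecurrent s e → G.SJoinable s e (e + x) := by
    intro e he
    obtain ⟨y, hy, _⟩ := he D
    have h1 : G.SAccessible s (D + y + x) (D + y) := by
      have := ht.add_right (y + x)
      rwa [← hx, show t + (y + x) = t + x + y by abel,
        show t + x + (y + x) = t + x + y + x by abel, hx] at this
    exact sJoinable_equivalence.trans
      (sJoinable_equivalence.symm (SAccessible.sJoinable (h1.trans hy))) (hy.add_right x).sJoinable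
  have hcd : G.SJoinable s (c + x) (d + x) :=
    hB _ _ (hBx.trans fun v => Nat.le_add_left _ _) (by
      rw [chips_add, chips_add, add_sub_add_right_eq_sub])
  exact hc.sStable.eq_of_sJoinable hd.sStable (sJoinable_equivalence.trans (key c hc)
    (sJoinable_equivalence.trans hcd (sJoinable_equivalence.symm (key d hd))))

/-! ### The case of a single class -/

/-- Recurrent configurations that agree modulo the firing lattice after `k` firings of the sink
are equivalent. -/
theorem sEquiv_of_chips_mem (hG : ∀ c, ∃ d, G.Stabilizes s c d) {c d : G.SRec s} {k : ℕ}
    (h : chips c.1 - (chips d.1 + k • chips (G.sinkVector s)) ∈ G.firingLattice s) :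
    G.SEquiv s d c := by
  obtain ⟨e, he⟩ := hG (d.1 + k • G.sinkVector s)
  have hc : chips (d.1 + k • G.sinkVector s) = chips d.1 + k • chips (G.sinkVector s) := by
    ext v
    simp
  have hce : c.1 = e := by
    refine c.2.eq_of_chips_sub_mem hG (d.2.of_stabilizes_add he) ?_
    rw [← sub_add_sub_cancel _ (chips d.1 + k • chips (G.sinkVector s))]
    exact add_mem h (hc ▸ he.1.chips_sub_mem)
  exact ⟨k, hce ▸ he⟩

/-- If the firing vectors and the sink vector generate the whole lattice, there is at most one
class of recurrent configurations. -/
theorem subsingleton_sRecClass (hG : ∀ c, ∃ d, G.Stabilizes s c d)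
    (h : G.firingLattice s ⊔ AddSubgroup.zmultiples (chips (G.sinkVector s)) = ⊤) :
    Subsingleton (G.SRecClass s) := by
  refine ⟨fun p q => ?_⟩
  induction p using Quot.ind with | _ c
  induction q using Quot.ind with | _ d
  obtain ⟨z, hz, u, hu, hzu⟩ := AddSubgroup.mem_sup.1
    (h ▸ AddSubgroup.mem_top (chips c.1 - chips d.1))
  obtain ⟨k, rfl⟩ := AddSubgroup.mem_zmultiples_iff.1 hu
  -- The sign of `k` decides which of the two configurations is fed from the sink.
  obtain ⟨m, rfl | rfl⟩ := k.eq_nat_or_neg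
  · refine (Quot.sound (sEquiv_of_chips_mem hG (k := m) ?_)).symm
    rw [natCast_zsmul] at hzu
    rwa [← sub_sub, ← hzu, add_sub_cancel_right]
  · refine Quot.sound (sEquiv_of_chips_mem hG (k := m) ?_)
    rw [neg_smul, natCast_zsmul] at hzu
    have key : chips d.1 - (chips c.1 + m • chips (G.sinkVector s)) = -z := by
      rw [eq_sub_of_add_eq hzu]
      abel
    exact key ▸ neg_mem hz

/-! ### Existence of stabilizations and the largest recurrent configuration -/

/-- A configuration can be stabilized if there is a function `h` on the vertices that is strictly
superharmonic away from the sink: every firing lowers `∑ v, c v * h v`. -/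
theorem exists_stabilizes [Fintype V] (h : V → ℕ)
    (hh : ∀ v ≠ s, ∑ w, G.mult v w * h w < G.outdeg v * h v) (c : SConfig s) :
    ∃ d, G.Stabilizes s c d := by
  induction hn : ∑ v, c v * h v using Nat.strong_induction_on generalizing c with
  | _ n ih =>
    by_cases hc : G.SStable s c
    · exact ⟨c, .refl, hc⟩
    simp only [SStable, not_forall, not_lt] at hc
    obtain ⟨v, hv⟩ := hc
    let d : SConfig s := fun w => c w + G.mult v w - (if w = v then G.outdeg v else 0)
    have hd : ∀ w, d w + (if w = v then G.outdeg v else 0) = c w + G.mult v w := by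
      intro w
      refine Nat.sub_add_cancel ?_
      split_ifs with hw
      · subst hw
        omega
      · exact Nat.zero_le _
    have hsum : ∑ w, d w * h w + G.outdeg v * h v =
        ∑ w, c w * h w + ∑ w : {v : V // v ≠ s}, G.mult v w * h w := by
      rw [← Finset.sum_add_distrib]
      simp_rw [← add_mul, ← hd, add_mul, Finset.sum_add_distrib, ite_mul, zero_mul]
      simp
    have hle : ∑ w : {v : V // v ≠ s}, G.mult v w * h w ≤ ∑ w, G.mult v w * h w := by
      rw [← Finset.sum_subtype (Finset.univ.filter (· ≠ s)) (by simp)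
        (fun w => G.mult v w * h w)]
      exact Finset.sum_le_sum_of_subset (Finset.filter_subset _ _)
    have := hh v v.2
    obtain ⟨e, he, hes⟩ := ih _ (by omega) d rfl
    exact ⟨e, .head ⟨v, hv, hd⟩ he, hes⟩

/-- The stable configuration that dominates all the others is recurrent: what is missing after
stabilizing a given configuration can be added. -/
theorem sRecurrent_max (hG : ∀ c, ∃ d, G.Stabilizes s c d)
    (hpos : ∀ v ≠ s, 0 < G.outdeg v) :
    G.SRecurrent s fun v => G.outdeg v - 1 := by
  intro c
  obtain ⟨d, hd, hds⟩ := hG c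
  refine ⟨fun v => G.outdeg v - 1 - d v, ?_, fun v => Nat.sub_lt (hpos v v.2) one_pos⟩
  convert hd.add_right fun v => G.outdeg v - 1 - d v using 1
  ext v
  have := hds v
  simp only [Pi.add_apply]
  omega

theorem sum_outdeg [Fintype V] (G : MultiDigraph V E) :
    ∑ v, G.outdeg v = Fintype.card E :=
  (Finset.card_eq_sum_card_fiberwise (f := G.src) (t := Finset.univ) (by simp)).symm

/-- With a single class, the Biggs–Merino polynomial is the monomial whose degree is the d-level
of the largest stable configuration. -/
theorem biggsMerino_eq_X_pow [Fintype V] (hG : ∀ c, ∃ d, G.Stabilizes s c d)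
    (hpos : ∀ v ≠ s, 0 < G.outdeg v) (h : Subsingleton (G.SRecClass s)) :
    G.biggsMerino s = Polynomial.X ^ (Fintype.card E - (Fintype.card V - 1)) := by
  let q : G.SRecClass s := Quot.mk _ ⟨_, sRecurrent_max hG hpos⟩
  have hq : G.classDlvl s q = G.dlvl s fun v => G.outdeg v - 1 := by
    refine (G.isGreatest_classDlvl s q).unique ⟨⟨_, rfl, rfl⟩, ?_⟩
    rintro m ⟨c, -, rfl⟩
    exact Nat.add_le_add_left
      (Finset.sum_le_sum fun v _ => Nat.le_sub_one_of_lt (c.2.sStable v)) _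
  have hd : G.dlvl s (fun v => G.outdeg v - 1) + (Fintype.card V - 1) = Fintype.card E := by
    have hcard : Fintype.card V - 1 = ∑ _v : {v : V // v ≠ s}, 1 := by
      rw [Finset.sum_const, Finset.card_univ, smul_eq_mul, mul_one, Fintype.card_subtype_compl]
      simp
    rw [dlvl, hcard, add_assoc, ← Finset.sum_add_distrib, ← sum_outdeg G,
      Fintype.sum_eq_add_sum_subtype_ne _ s]
    exact congrArg _ (Finset.sum_congr rfl fun v _ => Nat.sub_add_cancel (hpos v v.2))
  rw [biggsMerino, Fintype.sum_subsingleton _ q, hq, Nat.eq_sub_of_add_eq hd]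

end Confluence

/-! ### Multiplying all edge multiplicities by a constant -/

section Combine

variable {V : Type*} {s : V} {d : ℕ}

/-- The configuration `d c + r` with quotient `c` and remainder `r`. -/
def combine (d : ℕ) (c : SConfig s) (r : {v : V // v ≠ s} → Fin d) : SConfig s :=
  fun v => d * c v + r v

/-- The quotient of a configuration by `d`. -/
def quo (d : ℕ) (c : SConfig s) : SConfig s := fun v => c v / d

/-- The remainder of a configuration modulo `d`. -/
def rem (d : ℕ) [NeZero d] (c : SConfig s) : {v : V // v ≠ s} → Fin d :=
  fun v => Fin.ofNat d (c v)

variable [NeZero d]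

theorem combine_quo_rem (c : SConfig s) : combine d (quo d c) (rem d c) = c := by
  ext v
  simp [combine, quo, rem, Nat.div_add_mod]

theorem quo_combine (c : SConfig s) (r : {v : V // v ≠ s} → Fin d) : quo d (combine d c r) = c := by
  ext v
  simp [combine, quo, Nat.mul_add_div (NeZero.pos d), Nat.div_eq_of_lt (r v).2]

theorem rem_combine (c : SConfig s) (r : {v : V // v ≠ s} → Fin d) :
    rem d (combine d c r) = r := by
  ext v
  simp [combine, rem, Nat.mod_eq_of_lt (r v).2]

end Combine

section Scaling

variable {V E F : Type*} [DecidableEq V] [Fintype E] [Fintype F]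

/-- `H` has the multiplicities and outdegrees of `G`, multiplied by `d`. -/
structure IsScaling (G : MultiDigraph V E) (H : MultiDigraph V F) (d : ℕ) : Prop where
  mult (v w : V) : H.mult v w = d * G.mult v w
  outdeg (v : V) : H.outdeg v = d * G.outdeg v

theorem isScaling_replicate (G : MultiDigraph V E) (d : ℕ) : G.IsScaling (G.replicate d) d where
  mult v w := by
    have : (Finset.univ.filter fun e => (G.replicate d).src e = v ∧ (G.replicate d).tgt e = w) =
        (Finset.univ.filter fun e => G.src e = v ∧ G.tgt e = w) ×ˢ Finset.univ := by
      ext e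
      simp only [Finset.mem_filter, Finset.mem_product, Finset.mem_univ, true_and, and_true]
      exact Iff.rfl
    rw [MultiDigraph.mult, this, Finset.card_product, Finset.card_fin, mul_comm, MultiDigraph.mult]
  outdeg v := by
    have : (Finset.univ.filter fun e => (G.replicate d).src e = v) =
        (Finset.univ.filter fun e => G.src e = v) ×ˢ Finset.univ := by
      ext e
      simp only [Finset.mem_filter, Finset.mem_product, Finset.mem_univ, true_and, and_true]
      exact Iff.rfl
    rw [MultiDigraph.outdeg, this, Finset.card_product, Finset.card_fin, mul_comm,
      MultiDigraph.outdeg]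

namespace IsScaling

variable {G : MultiDigraph V E} {H : MultiDigraph V F} {s : V} {d : ℕ}

theorem sFires_combine (h : G.IsScaling H d) {c c' : SConfig s} (hc : G.SFires s c c')
    (r : {v : V // v ≠ s} → Fin d) : H.SFires s (combine d c r) (combine d c' r) := by
  obtain ⟨v, hv, hw⟩ := hc
  refine ⟨v, ?_, fun w => ?_⟩
  · rw [h.outdeg]
    exact (Nat.mul_le_mul_left d hv).trans (Nat.le_add_right _ _)
  · have := congrArg (d * ·) (hw w)
    simp only [mul_add, mul_ite, mul_zero] at this
    simp only [combine, h.outdeg, h.mult]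
    omega

theorem stabilizes_combine (h : G.IsScaling H d) {c c' : SConfig s} (hc : G.Stabilizes s c c')
    (r : {v : V // v ≠ s} → Fin d) : H.Stabilizes s (combine d c r) (combine d c' r) := by
  refine ⟨Relation.ReflTransGen.lift (p := H.SFires s) (combine d · r)
    (fun _ _ hc => h.sFires_combine hc r) _ _ hc.1, fun v => ?_⟩
  rw [h.outdeg]
  calc d * c' v + r v < d * (c' v + 1) := by have := (r v).2; rw [mul_add]; omega
    _ ≤ d * G.outdeg v := Nat.mul_le_mul_left d (hc.2 v)

theorem combine_add_sinkVector (h : G.IsScaling H d) (c : SConfig s) (k : ℕ)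
    (r : {v : V // v ≠ s} → Fin d) :
    combine d (c + k • G.sinkVector s) r = combine d c r + k • H.sinkVector s := by
  ext v
  simp only [combine, Pi.add_apply, Pi.smul_apply, sinkVector, h.mult, smul_eq_mul]
  ring

theorem dlvl_combine [Fintype V] (h : G.IsScaling H d) (c : SConfig s)
    (r : {v : V // v ≠ s} → Fin d) :
    H.dlvl s (combine d c r) = d * G.dlvl s c + ∑ v, (r v : ℕ) := by
  simp only [dlvl, combine, h.outdeg, Finset.sum_add_distrib, mul_add, Finset.mul_sum, add_assoc]

variable [NeZero d]

theorem sFires_quo (h : G.IsScaling H d) {c c' : SConfig s} (hc : H.SFires s c c') :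
    G.SFires s (quo d c) (quo d c') ∧ rem d c = rem d c' := by
  obtain ⟨v, hv, hw⟩ := hc
  have key : ∀ w, c' w + d * (if w = v then G.outdeg v else 0) = c w + d * G.mult v w := by
    intro w
    have := hw w
    rw [h.outdeg, h.mult] at this
    rw [← this, mul_ite, mul_zero]
  refine ⟨⟨v, ?_, fun w => ?_⟩, ?_⟩
  · rw [h.outdeg] at hv
    exact (Nat.le_div_iff_mul_le (NeZero.pos d)).2 (by rwa [mul_comm])
  · have := congrArg (· / d) (key w)
    simp only [Nat.add_mul_div_left _ _ (NeZero.pos d)] at this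
    exact this
  · ext w
    have := congrArg (· % d) (key w)
    simp only [Nat.add_mul_mod_self_left] at this
    simp [rem, this]

theorem stabilizes_quo (h : G.IsScaling H d) {c c' : SConfig s} (hc : H.Stabilizes s c c') :
    G.Stabilizes s (quo d c) (quo d c') ∧ rem d c = rem d c' := by
  refine ⟨⟨Relation.ReflTransGen.lift (p := G.SFires s) (quo d)
    (fun _ _ hc => (h.sFires_quo hc).1) _ _ hc.1, fun v => ?_⟩, ?_⟩
  · have := hc.2 v
    rw [h.outdeg] at this
    exact Nat.div_lt_of_lt_mul this
  · obtain ⟨hc, -⟩ := hc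
    induction hc with
    | refl => rfl
    | tail _ hf ih => exact ih.trans (h.sFires_quo hf).2

theorem sRecurrent_combine (h : G.IsScaling H d) {c : SConfig s} (hc : G.SRecurrent s c)
    (r : {v : V // v ≠ s} → Fin d) : H.SRecurrent s (combine d c r) := by
  intro c₁
  -- One extra chip at each vertex of `G` makes room for the remainders of `c₁`.
  obtain ⟨c₂, hc₂⟩ := hc (quo d c₁ + 1)
  refine ⟨fun v => combine d (quo d c₁ + 1 + c₂) r v - c₁ v, ?_⟩
  convert h.stabilizes_combine hc₂ r using 1
  ext v
  refine Nat.add_sub_cancel' ?_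
  calc c₁ v = d * (c₁ v / d) + c₁ v % d := (Nat.div_add_mod _ _).symm
    _ ≤ d * (c₁ v / d + 1) := by
      have := Nat.mod_lt (c₁ v) (NeZero.pos d)
      rw [mul_add]
      omega
    _ ≤ d * (c₁ v / d + 1 + c₂ v) := Nat.mul_le_mul_left d (Nat.le_add_right _ _)
    _ ≤ _ := Nat.le_add_right _ _

theorem sRecurrent_quo (h : G.IsScaling H d) {c : SConfig s} (hc : H.SRecurrent s c) :
    G.SRecurrent s (quo d c) := by
  intro c₁
  obtain ⟨c₂, hc₂⟩ := hc (combine d c₁ 0)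
  refine ⟨quo d c₂, ?_⟩
  convert (h.stabilizes_quo hc₂).1 using 1
  ext v
  simp [quo, combine, Nat.mul_add_div (NeZero.pos d)]

/-- Taking quotient and remainder modulo `d` identifies the classes of `H` with pairs of a class
of `G` and a vector of remainders. -/
def classEquiv (h : G.IsScaling H d) (s : V) :
    H.SRecClass s ≃ G.SRecClass s × ({v : V // v ≠ s} → Fin d) where
  toFun := Quot.lift (fun c => (Quot.mk _ ⟨quo d c.1, h.sRecurrent_quo c.2⟩, rem d c.1)) (by
    rintro c c' ⟨k, hk⟩
    rw [← combine_quo_rem (d := d) c.1, ← h.combine_add_sinkVector] at hk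
    have := h.stabilizes_quo hk
    rw [quo_combine, rem_combine] at this
    exact Prod.ext (Quot.sound ⟨k, this.1⟩) this.2)
  invFun p := Quot.map (fun c => ⟨combine d c.1 p.2, h.sRecurrent_combine c.2 p.2⟩) (by
    rintro c c' ⟨k, hk⟩
    refine ⟨k, ?_⟩
    rw [← h.combine_add_sinkVector]
    exact h.stabilizes_combine hk p.2) p.1
  left_inv q := by
    induction q using Quot.ind with | _ c
    exact congrArg (Quot.mk _) (Subtype.ext (combine_quo_rem c.1))
  right_inv p := by
    obtain ⟨q, r⟩ := p
    induction q using Quot.ind with | _ c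
    exact Prod.ext (congrArg (Quot.mk _) (Subtype.ext (quo_combine c.1 r))) (rem_combine c.1 r)

theorem classDlvl_classEquiv_symm [Fintype V] (h : G.IsScaling H d) (q : G.SRecClass s)
    (r : {v : V // v ≠ s} → Fin d) :
    H.classDlvl s ((h.classEquiv s).symm (q, r)) = d * G.classDlvl s q + ∑ v, (r v : ℕ) := by
  have hG := G.isGreatest_classDlvl s q
  refine (H.isGreatest_classDlvl s _).unique ⟨?_, ?_⟩
  · obtain ⟨c, hc, hm⟩ := hG.1
    exact ⟨⟨combine d c.1 r, h.sRecurrent_combine c.2 r⟩, by rw [← hc]; rfl,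
      by rw [← hm, ← h.dlvl_combine]⟩
  · rintro m ⟨c, hc, rfl⟩
    replace hc := ((h.classEquiv s).eq_symm_apply).1 hc
    obtain ⟨h1, h2⟩ := Prod.ext_iff.1 hc
    rw [← combine_quo_rem (d := d) c.1, h.dlvl_combine]
    have h3 : rem d c.1 = r := h2
    rw [h3]
    exact Nat.add_le_add_right (Nat.mul_le_mul_left d (hG.2 ⟨_, h1, rfl⟩)) _

theorem biggsMerino_eq [Fintype V] (h : G.IsScaling H d) (s : V) :
    H.biggsMerino s = (G.biggsMerino s).comp (Polynomial.X ^ d) *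
      (∑ i ∈ Finset.range d, Polynomial.X ^ i) ^ (Fintype.card V - 1) := by
  have hsum : ∑ r : {v : V // v ≠ s} → Fin d, (Polynomial.X : Polynomial ℤ) ^ ∑ v, (r v : ℕ) =
      (∑ i ∈ Finset.range d, Polynomial.X ^ i) ^ (Fintype.card V - 1) := by
    have hcard : Fintype.card V - 1 = (Finset.univ : Finset {v : V // v ≠ s}).card := by
      rw [Finset.card_univ, Fintype.card_subtype_compl]
      simp
    rw [hcard, ← Finset.prod_const, ← Fin.sum_univ_eq_sum_range, Finset.prod_univ_sum,
      Fintype.piFinset_univ]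
    simp_rw [Finset.prod_pow_eq_pow_sum]
  rw [← hsum, biggsMerino, biggsMerino, ← (h.classEquiv s).symm.sum_comp,
    Fintype.sum_prod_type, Polynomial.sum_comp, Finset.sum_mul_sum]
  simp_rw [classDlvl_classEquiv_symm, Polynomial.X_pow_comp, ← pow_mul, ← pow_add]

theorem algebraMap_biggsMerino_eq [Fintype V] (h : G.IsScaling H d) (s : V) :
    algebraMap (Polynomial ℤ) (RatFunc ℤ) (H.biggsMerino s) =
      algebraMap (Polynomial ℤ) (RatFunc ℤ) ((G.biggsMerino s).comp (Polynomial.X ^ d)) *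
        ((1 - RatFunc.X ^ d) / (1 - RatFunc.X)) ^ (Fintype.card V - 1) := by
  have hX : (1 : RatFunc ℤ) - RatFunc.X ≠ 0 := by
    rw [← RatFunc.algebraMap_X, ← map_one (algebraMap (Polynomial ℤ) (RatFunc ℤ)), ← map_sub]
    exact RatFunc.algebraMap_ne_zero (sub_ne_zero.2 fun h => by
      simpa using congrArg (Polynomial.eval 0) h)
  rw [h.biggsMerino_eq, map_mul, map_pow, map_sum]
  simp only [map_pow, RatFunc.algebraMap_X]
  rw [eq_div_of_mul_eq hX (mul_comm _ _ |>.trans (mul_neg_geom_sum RatFunc.X d))]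

end IsScaling

end Scaling

/-! ### Bidirected paths -/

section BiPath

theorem sum_fin_eq_ite {M : Type*} [AddCommMonoid M] {m : ℕ} (f : Fin m → M) (k : ℕ) (x : M)
    (h : ∀ i : Fin m, f i = if (i : ℕ) = k then x else 0) :
    ∑ i, f i = if k < m then x else 0 := by
  rw [Finset.sum_congr rfl fun i _ => h i,
    Fin.sum_univ_eq_sum_range (fun i => if i = k then x else 0) m, Finset.sum_ite_eq']
  simp only [Finset.mem_range]

theorem biPath_mult_eq_sum (n a b : ℕ) (v w : Fin n) :
    (biPath n a b).mult v w = ∑ i : Fin (n - 1),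
      ((if (i : ℕ) = v ∧ (i : ℕ) + 1 = w then a else 0) +
        (if (i : ℕ) + 1 = v ∧ (i : ℕ) = w then b else 0)) := by
  simp only [mult, biPath, Finset.card_filter, Fintype.sum_prod_type, Fintype.sum_sum_type,
    Fin.ext_iff]
  simp [apply_ite Finset.card]

theorem biPath_outdeg_eq_sum (n a b : ℕ) (v : Fin n) :
    (biPath n a b).outdeg v = ∑ i : Fin (n - 1),
      ((if (i : ℕ) = v then a else 0) + (if (i : ℕ) + 1 = v then b else 0)) := by
  simp only [outdeg, biPath, Finset.card_filter, Fintype.sum_prod_type, Fintype.sum_sum_type,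
    Fin.ext_iff]
  simp [apply_ite Finset.card]

/-- `biPath n (d * a) (d * b)` is isomorphic to `(biPath n a b).replicate d`, but only the
multiplicities and outdegrees matter. -/
theorem isScaling_biPath (n a b d : ℕ) :
    (biPath n a b).IsScaling (biPath n (d * a) (d * b)) d where
  mult v w := by
    simp only [biPath_mult_eq_sum, Finset.mul_sum, mul_add, mul_ite, mul_zero]
  outdeg v := by
    simp only [biPath_outdeg_eq_sum, Finset.mul_sum, mul_add, mul_ite, mul_zero]

variable {n a b : ℕ}

theorem biPath_mult (v w : Fin n) : (biPath n a b).mult v w =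
    (if (w : ℕ) = v + 1 then a else 0) + (if (v : ℕ) = w + 1 then b else 0) := by
  rw [biPath_mult_eq_sum, Finset.sum_add_distrib]
  have hv := v.2
  have hw := w.2
  congr 1
  · rw [sum_fin_eq_ite _ v (if (w : ℕ) = v + 1 then a else 0) fun i => by grind]
    grind
  · rw [sum_fin_eq_ite _ w (if (v : ℕ) = w + 1 then b else 0) fun i => by grind]
    grind

theorem biPath_outdeg (v : Fin n) : (biPath n a b).outdeg v =
    (if (v : ℕ) + 1 < n then a else 0) + (if 0 < (v : ℕ) then b else 0) := by
  rw [biPath_outdeg_eq_sum, Finset.sum_add_distrib]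
  have hv := v.2
  congr 1
  · rw [sum_fin_eq_ite _ v a fun i => rfl]
    grind
  · rw [sum_fin_eq_ite _ (v - 1) (if 0 < (v : ℕ) then b else 0) fun i => by grind]
    grind

theorem sum_biPath_mult_mul (v : Fin n) (h : ℕ → ℕ) :
    ∑ w, (biPath n a b).mult v w * h w =
      (if (v : ℕ) + 1 < n then a * h (v + 1) else 0) +
        (if 0 < (v : ℕ) then b * h (v - 1) else 0) := by
  simp only [biPath_mult, add_mul, Finset.sum_add_distrib]
  have hv := v.2
  congr 1
  · exact sum_fin_eq_ite _ (v + 1) (a * h (v + 1)) fun w => by grind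
  · rw [sum_fin_eq_ite _ (v - 1) (if 0 < (v : ℕ) then b * h (v - 1) else 0) fun w => by grind]
    grind

theorem biPath_outdeg_pos (ha : 0 < a) (hb : 0 < b) (s v : Fin n) (hv : v ≠ s) :
    0 < (biPath n a b).outdeg v := by
  rw [biPath_outdeg]
  have := v.2
  have := s.2
  have : (v : ℕ) ≠ s := fun h => hv (Fin.ext h)
  split_ifs <;> omega

/-- With base `K = a + b`, the function `t ↦ K ^ n - K ^ (n - t)` of the distance `t` to the sink
is so concave that one of the edges towards the sink outweighs all the edges away from it. -/
theorem concave_pow_sub (ha : 0 < a) (hb : 0 < b) {m t : ℕ} (ht : t + 2 ≤ m) :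
    b * ((a + b) ^ m - (a + b) ^ (m - t)) + a * ((a + b) ^ m - (a + b) ^ (m - (t + 2))) <
      (a + b) * ((a + b) ^ m - (a + b) ^ (m - (t + 1))) := by
  obtain ⟨k, rfl⟩ := Nat.exists_eq_add_of_le ht
  rw [show t + 2 + k - t = k + 2 by omega, show t + 2 + k - (t + 2) = k by omega,
    show t + 2 + k - (t + 1) = k + 1 by omega]
  have hK : 0 < a + b := by omega
  have h1 : (a + b) ^ (k + 2) ≤ (a + b) ^ (t + 2 + k) := Nat.pow_le_pow_right hK (by omega)
  have h2 : (a + b) ^ (k + 1) ≤ (a + b) ^ (t + 2 + k) := Nat.pow_le_pow_right hK (by omega)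
  have h3 : (a + b) ^ k ≤ (a + b) ^ (t + 2 + k) := Nat.pow_le_pow_right hK (by omega)
  zify [h1, h2, h3]
  have hp : (0 : ℤ) < (a + b) ^ k := by positivity
  have hb' : (1 : ℤ) ≤ b := by exact_mod_cast hb
  have ha' : (1 : ℤ) ≤ a := by exact_mod_cast ha
  have : 0 < ((b - 1) * ((a : ℤ) + b) ^ 2 + a) * (a + b) ^ k :=
    mul_pos (by nlinarith [sq_nonneg ((a : ℤ) + b)]) hp
  rw [pow_succ _ (k + 1), pow_succ _ k]
  linarith

theorem exists_stabilizes_biPath (ha : 0 < a) (hb : 0 < b) (s : Fin n) (c : SConfig s) :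
    ∃ d, (biPath n a b).Stabilizes s c d := by
  let g : ℕ → ℕ := fun t => (a + b) ^ n - (a + b) ^ (n - t)
  have hg : ∀ t, t < n → g t < g (t + 1) := by
    intro t ht
    have h1 : (a + b) ^ (n - (t + 1)) < (a + b) ^ (n - t) :=
      Nat.pow_lt_pow_right (by omega) (by omega)
    have h2 : (a + b) ^ (n - t) ≤ (a + b) ^ n := Nat.pow_le_pow_right (by omega) (by omega)
    show _ - _ < _ - _
    omega
  refine exists_stabilizes (fun v : Fin n => g ((v - s : ℕ) + (s - v : ℕ))) (fun v hvs => ?_) c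
  rw [sum_biPath_mult_mul v fun v => g ((v - s : ℕ) + (s - v : ℕ)), biPath_outdeg]
  have hv := v.2
  have hs := s.2
  rcases lt_or_gt_of_ne (fun h => hvs (Fin.ext h) : (v : ℕ) ≠ s) with h | h
  · obtain ⟨t, ht⟩ := Nat.exists_eq_add_of_lt h
    have h1 : (v : ℕ) + 1 < n := by omega
    rw [if_pos h1, if_pos h1, show (v + 1 - s + (s - (v + 1)) : ℕ) = t by omega,
      show (v - s + (s - v) : ℕ) = t + 1 by omega]
    split_ifs with h0
    · rw [show (v - 1 - s + (s - (v - 1)) : ℕ) = t + 2 by omega, add_comm a b]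
      have := concave_pow_sub hb ha (m := n) (t := t) (by omega)
      simpa only [g, add_comm a b] using this
    · simpa using Nat.mul_lt_mul_of_pos_left (hg t (by omega)) ha
  · obtain ⟨t, ht⟩ := Nat.exists_eq_add_of_lt h
    have h1 : 0 < (v : ℕ) := by omega
    rw [if_pos h1, if_pos h1,
      show (v - 1 - s + (s - (v - 1)) : ℕ) = t by omega,
      show (v - s + (s - v) : ℕ) = t + 1 by omega]
    split_ifs with h0
    · rw [show (v + 1 - s + (s - (v + 1)) : ℕ) = t + 2 by omega, add_comm (a * _)]
      exact concave_pow_sub ha hb (by omega)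
    · simpa using Nat.mul_lt_mul_of_pos_left (hg t (by omega)) hb

/-- Modulo a subgroup containing all `a f (i + 1) - b f i` and both ends of the sequence `f`, the
powers of `a` annihilate `f` going up; coprimality with `b` then makes it vanish going down. -/
theorem forall_mem_of_coprime {M : Type*} [AddCommGroup M] (A : AddSubgroup M) (f : ℕ → M)
    (hab : Nat.Coprime a b) (h0 : f 0 ∈ A) (hn : f n ∈ A)
    (h : ∀ i < n, a • f (i + 1) - b • f i ∈ A) : ∀ i ≤ n, f i ∈ A := by
  have up : ∀ i ≤ n, a ^ i • f i ∈ A := by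
    intro i
    induction i with
    | zero => simpa using h0
    | succ i ih =>
      intro hi
      have h1 := A.nsmul_mem (h i (by omega)) (a ^ i)
      have h2 := A.nsmul_mem (ih (by omega)) b
      convert A.add_mem h1 h2 using 1
      rw [smul_sub, ← mul_smul, ← mul_smul, ← mul_smul, pow_succ, mul_comm b, sub_add_cancel]
  intro i hi
  induction hi using Nat.decreasingInduction with
  | self => exact hn
  | of_succ i hi ih =>
    have h1 : b • f i ∈ A := by
      convert A.sub_mem (A.nsmul_mem ih a) (h i hi) using 1
      rw [sub_sub_cancel]
    have h2 := up i hi.le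
    have hcop : IsCoprime ((a ^ i : ℕ) : ℤ) (b : ℤ) :=
      Nat.isCoprime_iff_coprime.2 (hab.pow_left i)
    obtain ⟨u, w, huw⟩ := hcop
    have := A.add_mem (A.zsmul_mem h2 u) (A.zsmul_mem h1 w)
    rwa [← natCast_zsmul, ← natCast_zsmul, ← mul_smul, ← mul_smul, ← add_smul, huw,
      one_smul] at this

/-- For coprime `a` and `b` the sandpile group of the path becomes trivial once the sink vector
is divided out. -/
theorem firingLattice_biPath_sup_eq_top (hab : Nat.Coprime a b) (s : Fin n) :
    (biPath n a b).firingLattice s ⊔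
      AddSubgroup.zmultiples (chips ((biPath n a b).sinkVector s)) = ⊤ := by
  set A := (biPath n a b).firingLattice s ⊔
      AddSubgroup.zmultiples (chips ((biPath n a b).sinkVector s))
  -- The coordinate vectors; the one of the sink is zero.
  let e : ℕ → {v : Fin n // v ≠ s} → ℤ := fun i w => if (w : ℕ) = i then 1 else 0
  -- Differences of consecutive coordinate vectors, with `f 0 = f n = 0`: then
  -- `a f (i + 1) - b f i` is the firing vector of the vertex `i`, also at the ends of the path,
  -- and minus the sink vector if `i` is the sink.
  let f : ℕ → {v : Fin n // v ≠ s} → ℤ := fun i => if i = 0 ∨ i = n then 0 else e (i - 1) - e i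
  have hfw : ∀ i w, f i w = if i = 0 ∨ i = n then 0 else
      (if (w : ℕ) = i - 1 then 1 else 0) - if (w : ℕ) = i then 1 else 0 := by
    intro i w
    by_cases h : i = 0 ∨ i = n <;> simp only [f, e, h, if_true, if_false, Pi.zero_apply,
      Pi.sub_apply]
  have hf : ∀ i ≤ n, f i ∈ A := by
    refine forall_mem_of_coprime A f hab (by simp [f]) (by simp [f]) fun i hi => ?_
    by_cases his : i = s
    · have : a • f (i + 1) - b • f i = -chips ((biPath n a b).sinkVector s) := by
        ext w
        have hw : (w : ℕ) ≠ s := fun h => w.2 (Fin.ext h)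
        have hwn := w.1.2
        simp only [sinkVector, biPath_mult, chips_apply, Pi.sub_apply, Pi.smul_apply,
          Pi.neg_apply, hfw]
        simp only [nsmul_eq_mul]
        grind
      rw [this]
      exact neg_mem (AddSubgroup.mem_sup_right (AddSubgroup.mem_zmultiples _))
    · have : a • f (i + 1) - b • f i =
          (biPath n a b).firingVector s ⟨⟨i, hi⟩, fun h => his (congrArg Fin.val h)⟩ := by
        ext w
        have hwn := w.1.2
        simp only [firingVector, biPath_mult, biPath_outdeg, Pi.sub_apply, Pi.smul_apply, hfw,
          Subtype.ext_iff, Fin.ext_iff]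
        simp only [nsmul_eq_mul]
        grind
      rw [this]
      exact AddSubgroup.mem_sup_left (AddSubgroup.subset_closure ⟨_, rfl⟩)
  have hstep : ∀ i, i + 1 < n → (e (i + 1) ∈ A ↔ e i ∈ A) := by
    intro i hi
    have h1 := hf (i + 1) hi.le
    simp only [f, add_eq_zero, one_ne_zero, and_false, hi.ne, or_self, if_false,
      Nat.add_sub_cancel] at h1
    exact ⟨fun h => by simpa using A.add_mem h1 h, fun h => by simpa using A.sub_mem h h1⟩
  have hzero : ∀ i < n, (e i ∈ A ↔ e 0 ∈ A) := by
    intro i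
    induction i with
    | zero => simp
    | succ i ih => exact fun hi => (hstep i hi).trans (ih (by omega))
  have hes : e s = 0 := by
    ext w
    exact if_neg fun h => w.2 (Fin.ext h)
  have he : ∀ i < n, e i ∈ A := fun i hi =>
    (hzero i hi).2 ((hzero s s.2).1 (hes ▸ A.zero_mem))
  refine (AddSubgroup.eq_top_iff' _).2 fun z => ?_
  have hz : z = ∑ w, z w • e w := by
    ext w
    simp [e, Finset.sum_apply, ← Fin.ext_iff, ← Subtype.ext_iff]
  rw [hz]
  exact A.sum_mem fun w _ => A.zsmul_mem (he w w.1.2) _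

theorem biggsMerino_biPath_of_coprime (ha : 0 < a) (hb : 0 < b) (hab : Nat.Coprime a b)
    (s : Fin n) :
    (biPath n a b).biggsMerino s = Polynomial.X ^ ((n - 1) * (a + b - 1)) := by
  rw [biggsMerino_eq_X_pow (exists_stabilizes_biPath ha hb s)
    (fun v hv => biPath_outdeg_pos ha hb s v hv)
    (subsingleton_sRecClass (exists_stabilizes_biPath ha hb s)
      (firingLattice_biPath_sup_eq_top hab s))]
  simp [Nat.mul_sub]

end BiPath

end MultiDigraph

theorem lemma5p1 :
    (∀ (V E : Type*) [Fintype V] [DecidableEq V] [Fintype E] (G : MultiDigraph V E),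
      G.StronglyConnected → ∀ (s : V) (d : ℕ), 0 < d →
        algebraMap (Polynomial ℤ) (RatFunc ℤ) ((G.replicate d).biggsMerino s) =
          algebraMap (Polynomial ℤ) (RatFunc ℤ) ((G.biggsMerino s).comp (Polynomial.X ^ d)) *
            ((1 - RatFunc.X ^ d) / (1 - RatFunc.X)) ^ (Fintype.card V - 1)) ∧
    (∀ n a b : ℕ, 0 < n → 0 < a → 0 < b → ∀ s : Fin n,
      algebraMap (Polynomial ℤ) (RatFunc ℤ) ((MultiDigraph.biPath n a b).biggsMerino s) =
        RatFunc.X ^ ((n - 1) * (a + b - Nat.gcd a b)) *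
          ((1 - RatFunc.X ^ Nat.gcd a b) / (1 - RatFunc.X)) ^ (n - 1)) := by
  refine ⟨fun V E _ _ _ G _ s d hd => ?_, fun n a b _ ha hb s => ?_⟩
  · have : NeZero d := ⟨hd.ne'⟩
    exact (G.isScaling_replicate d).algebraMap_biggsMerino_eq s
  · obtain ⟨a', b', hab, ha', hb'⟩ := Nat.exists_coprime a b
    have hd : 0 < Nat.gcd a b := Nat.gcd_pos_of_pos_left b ha
    generalize Nat.gcd a b = d at *
    subst ha' hb'
    have : NeZero d := ⟨hd.ne'⟩
    have h := (MultiDigraph.isScaling_biPath n a' b' d).algebraMap_biggsMerino_eq s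
    rw [MultiDigraph.biggsMerino_biPath_of_coprime (Nat.pos_of_mul_pos_right ha)
      (Nat.pos_of_mul_pos_right hb) hab, Polynomial.X_pow_comp, ← pow_mul, map_pow,
      RatFunc.algebraMap_X, Fintype.card_fin] at h
    rw [mul_comm a', mul_comm b', h]
    congr 2
    rw [mul_left_comm, Nat.mul_sub, mul_add, mul_one]
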